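/- Work in the universe of sets. Set functions are written $f(\vec x/\vec a)$, with a finite (possibly empty) list $\vec x=x_1,\dots,x_n$ of normal arguments and a finite (possibly empty) list $\vec a=a_1,\dots,a_m$ of safe arguments; "$-$" denotes the empty list. Let $\mathsf{PCSF}^-$ be the smallest class of functions $f(- /\vec a)$ without normal arguments that contains the projections $\pi_j(- /a_1,\dots,a_m)=a_j$ $(1\le j\le m)$, $\mathrm{pair}(- /a,b)=\{a,b\}$, $\mathrm{null}(- / -)=\emptyset$, $\mathrm{union}(- /a)=\bigcup a$, and $\mathrm{Cond}_\in(- /a,b,c,d)$, which equals $a$ if $c\in d$ and $b$ otherwise, and that is closed under composition $f(- /\vec a)=h(- /t_1(- /\vec a),\dots,t_k(- /\vec a))$ and safe separation $f(- /\vec a,c)=\{b\in c: h(- /\vec a,b)\neq\emptyset\}$. Let $\mathsf{PCSF}$ be the smallest class of functions $f(\vec x/\vec a)$ that contains $\mathsf{PCSF}^-$ and all projections to a normal or a safe argument, and that is closed under safe composition $$f(\vec x/\vec a)=h(r_1(\vec x/ -),\dots,r_k(\vec x/ -)\,/\,t_1(\vec x/\vec a),\dots,t_l(\vec x/\vec a))$$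 and predicative set recursion $$f(x,\vec y/\vec a)=h(x,\vec y/\vec a,\{f(z,\vec y/\vec a): z\in x\}).$$ Encode finite binary strings by hereditarily finite sets: $\nu(\epsilon)=\emptyset$ for the empty string $\epsilon$, and $\nu(si)=\langle i+1,\nu(s)\rangle$ for $i\in\{0,1\}$, where $\langle c,d\rangle=\{\{c\},\{c,d\}\}$, $1=\{\emptyset\}$ and $2=\{\emptyset,\{\emptyset\}\}$. **Lemma 4.1.** Let $n\ge 0$. For every polynomial time computable function $f(s_1,\dots,s_n)$ from $n$-tuples of finite binary strings to finite binary strings there is a function $F\in\mathsf{PCSF}$ with $n$ normal and no safe arguments such that, for all finite binary strings $s_1,\dots,s_n$, $$F(\nu(s_1),\dots,\nu(s_n)/ -)=\nu(f(s_1,\dots,s_n)).$$ -/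

import Mathlib

universe u

/-- The class `PCSF⁻` of set functions `f( / a₁,…,a_m)` without normal arguments
(normal arguments are written before the slash, safe arguments after it). -/
inductive PCSFMinus : ∀ {m : ℕ}, ((Fin m → ZFSet.{u}) → ZFSet.{u}) → Prop
  /-- (Projection) on safe arguments. -/
  | proj {m : ℕ} (j : Fin m) : PCSFMinus (fun a => a j)
  /-- (Pair) `pair( / a,b) = {a, b}`. -/
  | pair : PCSFMinus (fun a : Fin 2 → ZFSet.{u} => {a 0, a 1})
  /-- (Null) `null( / ) = ∅`. -/
  | null : PCSFMinus (fun _ : Fin 0 → ZFSet.{u} => ∅)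
  /-- (Union) `union( / a) = ⋃ a`. -/
  | union : PCSFMinus (fun a : Fin 1 → ZFSet.{u} => ZFSet.sUnion (a 0))
  /-- (Conditional∈) `Cond( / a,b,c,d) = a` if `c ∈ d`, and `= b` otherwise. -/
  | cond : PCSFMinus (fun a : Fin 4 → ZFSet.{u} =>
      open Classical in if a 2 ∈ a 3 then a 0 else a 1)
  /-- Composition `f( / a) = h( / t₁( / a),…,t_k( / a))`. -/
  | comp {m k : ℕ} {h : (Fin k → ZFSet.{u}) → ZFSet.{u}}
      {t : Fin k → (Fin m → ZFSet.{u}) → ZFSet.{u}}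
      (hh : PCSFMinus h) (ht : ∀ j, PCSFMinus (t j)) :
      PCSFMinus (fun a => h (fun j => t j a))
  /-- (Safe Separation) `f( / a,c) = {b ∈ c : h( / a,b) ≠ ∅}`; the last safe argument is `c`. -/
  | sep {m : ℕ} {h : (Fin (m + 1) → ZFSet.{u}) → ZFSet.{u}} (hh : PCSFMinus h) :
      PCSFMinus (fun v : Fin (m + 1) → ZFSet.{u} =>
        ZFSet.sep (fun b => h (Fin.snoc (α := fun _ => ZFSet.{u}) (Fin.init v) b) ≠ ∅)
          (v (Fin.last m)))

/-- The class `PCSF` of predicatively computable set functions `f(x₁,…,x_n/a₁,…,a_m)`, with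
`n` normal arguments `x` and `m` safe arguments `a`. -/
inductive PCSF :
    ∀ {n m : ℕ}, ((Fin n → ZFSet.{u}) → (Fin m → ZFSet.{u}) → ZFSet.{u}) → Prop
  /-- Every function in `PCSF⁻`, as a function with no normal arguments. -/
  | ofMinus {m : ℕ} {g : (Fin m → ZFSet.{u}) → ZFSet.{u}} (hg : PCSFMinus g) :
      PCSF (fun (_ : Fin 0 → ZFSet.{u}) a => g a)
  /-- (Projection) on a normal argument. -/
  | projNormal {n m : ℕ} (j : Fin n) :
      PCSF (fun (x : Fin n → ZFSet.{u}) (_ : Fin m → ZFSet.{u}) => x j)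
  /-- (Projection) on a safe argument. -/
  | projSafe {n m : ℕ} (j : Fin m) :
      PCSF (fun (_ : Fin n → ZFSet.{u}) (a : Fin m → ZFSet.{u}) => a j)
  /-- (Safe Composition) `f(x/a) = h(r₁(x/ ),…,r_k(x/ ) / t₁(x/a),…,t_l(x/a))`. -/
  | comp {n m k l : ℕ} {h : (Fin k → ZFSet.{u}) → (Fin l → ZFSet.{u}) → ZFSet.{u}}
      {r : Fin k → (Fin n → ZFSet.{u}) → (Fin 0 → ZFSet.{u}) → ZFSet.{u}}
      {t : Fin l → (Fin n → ZFSet.{u}) → (Fin m → ZFSet.{u}) → ZFSet.{u}}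
      (hh : PCSF h) (hr : ∀ i, PCSF (r i)) (ht : ∀ j, PCSF (t j)) :
      PCSF (fun x a => h (fun i => r i x Fin.elim0) (fun j => t j x a))
  /-- (Predicative Set Recursion) `f(x,y/a) = h(x,y/a,{f(z,y/a) : z ∈ x})`. By well-foundedness
  of `∈` this equation determines `f` from `h`. -/
  | setRec {n m : ℕ}
      {h : (Fin (n + 1) → ZFSet.{u}) → (Fin (m + 1) → ZFSet.{u}) → ZFSet.{u}}
      {f : (Fin (n + 1) → ZFSet.{u}) → (Fin m → ZFSet.{u}) → ZFSet.{u}}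
      (hh : PCSF h)
      (hf : ∀ (x : ZFSet.{u}) (y : Fin n → ZFSet.{u}) (a : Fin m → ZFSet.{u}),
        f (Fin.cons x y) a =
          h (Fin.cons x y) (Fin.snoc (α := fun _ => ZFSet.{u}) a
            (ZFSet.range (fun z : {z : ZFSet.{u} // z ∈ x} => f (Fin.cons z.1 y) a)))) :
      PCSF f

/-- The set coding a bit `i` inside a string code, namely the von Neumann numeral `i + 1`:
`1 = {0}` for the bit `0` (`false`) and `2 = {0, 1}` for the bit `1` (`true`). -/
noncomputable def bitCode : Bool → ZFSet.{u}
  | false => {∅}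
  | true => {∅, {∅}}

/-- The code `ν(s)` of a binary string `s`, written from left to right as a list of bits:
`ν(ε) = ∅` and `ν(s i) = ⟨i + 1, ν(s)⟩` with Kuratowski pairs, so that the last bit of the string
is outermost. -/
noncomputable def stringCode (s : List Bool) : ZFSet.{u} :=
  s.foldl (fun c i => ZFSet.pair (bitCode i) c) ∅

/-- A tuple of binary strings as one word over the three-letter alphabet `{0, 1, #}`, each string
being followed by the end marker `# = none`. -/
def tupleWord {n : ℕ} (s : Fin n → List Bool) : List (Option Bool) :=
  (List.ofFn s).flatMap (fun w => w.map some ++ [none])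

/-- `f(s₁,…,s_n)` is computable in polynomial time: a Turing machine (in Mathlib's multi-stack
model) that is given the word `s₁#s₂#…s_n#` halts with output `f(s₁,…,s_n)` within a number of
steps bounded by a polynomial in the length of that word. -/
def PolyTimeComputable {n : ℕ} (f : (Fin n → List Bool) → List Bool) : Prop :=
  Nonempty (Turing.TM2ComputableInPolyTime (tupleWord (n := n)) (id : List Bool → List Bool) f)

/-! One step of a fixed stack machine changes a bounded part of its configuration. If configurations
are coded by nested Kuratowski pairs, a step needs only pairing, pair projections and finitely many
case distinctions. All of these lie in `PCSFMinus`, so the step function takes its argument in safe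
position and may be iterated by predicative set recursion (`Turing.TM2.Coding.exists_step`,
`PCSF.exists_iterate`).

The clock for the iteration is a Zermelo numeral. Its only element is its predecessor, so the set of
recursive values along it is a singleton and union recovers the previous value. Addition and
multiplication of such numerals follow the normal/safe discipline familiar from Bellantoni and Cook,
hence every polynomial is available on normal numerals (`PCSF.exists_polynomial`). The starting
numeral is the rank of the coded input, computed by set recursion (`PCSF.exists_rank`). It is at
least the input length, and surplus steps are harmless because halted configurations are made to
rest.

Converting between string codes and stack codes is again an iteration, moving letters one at a time
from one list to another (`PCSF.exists_reverseAppend`). -/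

/-! ### Projections of Kuratowski pairs. -/

/-- First component of a Kuratowski pair. -/
noncomputable def kfst (p : ZFSet.{u}) : ZFSet.{u} :=
  ZFSet.sUnion (ZFSet.sep (fun z => {z} ∈ p) (ZFSet.sUnion p))

/-- Second component of a Kuratowski pair. -/
noncomputable def ksnd (p : ZFSet.{u}) : ZFSet.{u} :=
  -- This condition singles out the second component even when both components coincide; removing
  -- the first component would not.
  ZFSet.sUnion (ZFSet.sep (fun z => ZFSet.sUnion p = {kfst p, z}) (ZFSet.sUnion p))

theorem sUnion_kpair (a b : ZFSet.{u}) : ZFSet.sUnion (ZFSet.pair a b) = {a, b} := by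
  ext z
  simp [ZFSet.pair]

@[simp] theorem kfst_pair (a b : ZFSet.{u}) : kfst (ZFSet.pair a b) = a := by
  have h : ZFSet.sep (fun z => {z} ∈ ZFSet.pair a b) (ZFSet.sUnion (ZFSet.pair a b)) = {a} := by
    rw [sUnion_kpair]
    ext z
    simp only [ZFSet.mem_sep, ZFSet.mem_pair, ZFSet.mem_singleton, ZFSet.pair]
    constructor
    · rintro ⟨-, h | h⟩
      · exact ZFSet.singleton_injective h
      · have : a ∈ ({z} : ZFSet.{u}) := by rw [h]; simp
        exact (ZFSet.mem_singleton.1 this).symm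
    · rintro rfl
      simp
  rw [kfst, h, ZFSet.sUnion_singleton]

@[simp] theorem ksnd_pair (a b : ZFSet.{u}) : ksnd (ZFSet.pair a b) = b := by
  have h : ZFSet.sep (fun z => ZFSet.sUnion (ZFSet.pair a b) = {kfst (ZFSet.pair a b), z})
      (ZFSet.sUnion (ZFSet.pair a b)) = {b} := by
    rw [sUnion_kpair, kfst_pair]
    ext z
    simp only [ZFSet.mem_sep, ZFSet.mem_pair, ZFSet.mem_singleton]
    constructor
    · rintro ⟨hz | hz, h⟩
      · subst hz
        have : b ∈ ({z, z} : ZFSet.{u}) := by rw [← h]; simp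
        simpa [eq_comm] using this
      · exact hz
    · rintro rfl
      simp
  rw [ksnd, h, ZFSet.sUnion_singleton]

@[simp] theorem kfst_empty : kfst (∅ : ZFSet.{u}) = ∅ := by simp [kfst]

@[simp] theorem ksnd_empty : ksnd (∅ : ZFSet.{u}) = ∅ := by simp [ksnd]

theorem zsingleton_ne_empty (x : ZFSet.{u}) : ({x} : ZFSet.{u}) ≠ ∅ := by
  intro h
  have hx : x ∈ ({x} : ZFSet.{u}) := ZFSet.mem_singleton.2 rfl
  rw [h] at hx
  exact ZFSet.notMem_empty x hx

theorem kpair_ne_empty (a b : ZFSet.{u}) : ZFSet.pair a b ≠ ∅ := by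
  intro h
  have : ({a} : ZFSet.{u}) ∈ ZFSet.pair a b := by simp [ZFSet.pair]
  rw [h] at this
  exact ZFSet.notMem_empty _ this

/-! ### Closure properties of `PCSFMinus`. -/

namespace PCSFMinus

variable {m : ℕ} {s t c d : (Fin m → ZFSet.{u}) → ZFSet.{u}}

theorem pair_of (hs : PCSFMinus s) (ht : PCSFMinus t) :
    PCSFMinus (fun a => ({s a, t a} : ZFSet.{u})) :=
  comp (t := ![s, t]) pair (Fin.forall_fin_two.2 ⟨hs, ht⟩)

theorem empty : PCSFMinus (fun _ : Fin m → ZFSet.{u} => ∅) :=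
  comp (t := fun j : Fin 0 => j.elim0) null (fun j => j.elim0)

theorem singleton_of (hs : PCSFMinus s) : PCSFMinus (fun a => ({s a} : ZFSet.{u})) := by
  have h := pair_of hs hs
  simpa only [show ∀ x : ZFSet.{u}, ({x, x} : ZFSet.{u}) = {x} from
    fun x => by ext; simp] using h

theorem sUnion_of (hs : PCSFMinus s) : PCSFMinus (fun a => ZFSet.sUnion (s a)) :=
  comp (t := ![s]) union (by intro j; fin_cases j; exact hs)

open scoped Classical in
theorem ite_mem (hs : PCSFMinus s) (ht : PCSFMinus t) (hc : PCSFMinus c) (hd : PCSFMinus d) :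
    PCSFMinus (fun a => if c a ∈ d a then s a else t a) :=
  comp (t := ![s, t, c, d]) cond (by intro j; fin_cases j <;> assumption)

open scoped Classical in
theorem ite_eq (hs : PCSFMinus s) (ht : PCSFMinus t) (hc : PCSFMinus c) (hd : PCSFMinus d) :
    PCSFMinus (fun a => if c a = d a then s a else t a) := by
  simpa only [ZFSet.mem_singleton] using ite_mem hs ht hc (singleton_of hd)

theorem sep_of {h : (Fin m → ZFSet.{u}) → ZFSet.{u} → ZFSet.{u}} (hc : PCSFMinus c)
    (hh : PCSFMinus (fun v : Fin (m + 1) → ZFSet.{u} => h (Fin.init v) (v (Fin.last m)))) :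
    PCSFMinus (fun a => ZFSet.sep (fun b => h a b ≠ ∅) (c a)) := by
  have := comp (t := Fin.snoc (α := fun _ => (Fin m → ZFSet.{u}) → ZFSet.{u})
    (fun j a => a j) c) (sep hh) (by
      intro j
      refine Fin.lastCases ?_ (fun j => ?_) j
      · simpa using hc
      · simpa using proj j)
  simpa [Fin.init, Fin.init_def] using this

-- Safe separation tests nonemptiness, so the conditional first converts membership into the values
-- `{∅}` and `∅`.
open scoped Classical in
theorem sep_mem_of {e f : (Fin m → ZFSet.{u}) → ZFSet.{u} → ZFSet.{u}} (hc : PCSFMinus c)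
    (he : PCSFMinus (fun v : Fin (m + 1) → ZFSet.{u} => e (Fin.init v) (v (Fin.last m))))
    (hf : PCSFMinus (fun v : Fin (m + 1) → ZFSet.{u} => f (Fin.init v) (v (Fin.last m)))) :
    PCSFMinus (fun a => ZFSet.sep (fun b => e a b ∈ f a b) (c a)) := by
  have := sep_of (h := fun a b => if e a b ∈ f a b then {∅} else ∅) hc
    (ite_mem (singleton_of empty) empty he hf)
  convert this using 3
  funext b
  have h0 := zsingleton_ne_empty (∅ : ZFSet.{u})
  split_ifs with h <;> simp [h, h0]

theorem union_of (hs : PCSFMinus s) (ht : PCSFMinus t) :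
    PCSFMinus (fun a => s a ∪ t a) := by
  simpa only [ZFSet.sUnion_pair] using sUnion_of (pair_of hs ht)

open scoped Classical in
theorem sdiff_of (hs : PCSFMinus s) (ht : PCSFMinus t) :
    PCSFMinus (fun a => s a \ t a) := by
  have hp : PCSFMinus (fun v : Fin (m + 1) → ZFSet.{u} => t (Fin.init v)) :=
    comp (t := fun j v => v j.castSucc) ht (fun j => proj _)
  -- Non-membership becomes a membership: the conditional takes the value `{∅}` exactly when `b ∉ t
  -- a`.
  have := sep_mem_of (e := fun a b => if b ∈ t a then ∅ else {∅}) (f := fun _ _ => {{∅}}) hs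
    (ite_mem empty (singleton_of empty) (proj _) hp) (singleton_of (singleton_of empty))
  convert this using 2 with a
  ext z
  have h0 := (zsingleton_ne_empty (∅ : ZFSet.{u})).symm
  by_cases hz : z ∈ t a <;> simp [hz, h0]

theorem kpair_of (hs : PCSFMinus s) (ht : PCSFMinus t) :
    PCSFMinus (fun a => ZFSet.pair (s a) (t a)) :=
  pair_of (singleton_of hs) (pair_of hs ht)

/-- A unary function of `PCSF⁻`. -/
def Unary (g : ZFSet.{u} → ZFSet.{u}) : Prop :=
  PCSFMinus (fun a : Fin 1 → ZFSet.{u} => g (a 0))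

theorem Unary.of {g : ZFSet.{u} → ZFSet.{u}} (hg : Unary g) (hs : PCSFMinus s) :
    PCSFMinus (fun a => g (s a)) :=
  comp (t := ![s]) hg (by intro j; fin_cases j; exact hs)

theorem Unary.compose {g h : ZFSet.{u} → ZFSet.{u}} (hg : Unary g) (hh : Unary h) :
    Unary (fun z => g (h z)) :=
  hg.of hh

theorem unary_kfst : Unary kfst.{u} :=
  sUnion_of (sep_mem_of (m := 1) (e := fun _ b => {b}) (f := fun a _ => a 0) (sUnion_of (proj 0))
    (singleton_of (proj _)) (proj (Fin.castSucc 0)))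

theorem kfst_of (hs : PCSFMinus s) : PCSFMinus (fun a => kfst (s a)) :=
  unary_kfst.of hs

theorem unary_ksnd : Unary ksnd.{u} := by
  have := sUnion_of (sep_mem_of (m := 1) (e := fun a _ => ZFSet.sUnion (a 0))
    (f := fun a b => {{kfst (a 0), b}}) (sUnion_of (proj 0)) (sUnion_of (proj (Fin.castSucc 0)))
    (singleton_of (pair_of (kfst_of (proj (Fin.castSucc 0))) (proj _))))
  simp only [ZFSet.mem_singleton] at this
  exact this

theorem ksnd_of (hs : PCSFMinus s) : PCSFMinus (fun a => ksnd (s a)) :=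
  unary_ksnd.of hs

theorem proj_zero : PCSFMinus (fun a : Fin 1 → ZFSet.{u} => a 0) := proj 0

theorem unary_id : Unary (fun z : ZFSet.{u} => z) := proj 0

/-- Definition by cases according to which member of a finite set of codes occurs. -/
theorem exists_cases {ι : Type*} {I : Set ι} (hI : I.Finite) {e : ι → ZFSet.{u}}
    (he : ∀ i, PCSFMinus (fun _ : Fin m → ZFSet.{u} => e i))
    (hinj : I.InjOn e) (hc : PCSFMinus c)
    {H : ι → (Fin m → ZFSet.{u}) → ZFSet.{u}} (hH : ∀ i, PCSFMinus (H i)) :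
    ∃ G, PCSFMinus G ∧ ∀ i ∈ I, ∀ a, c a = e i → G a = H i a := by
  classical
  induction I, hI using Set.Finite.induction_on with
  | empty => exact ⟨_, empty, by simp⟩
  | @insert i I hi _ ih =>
    obtain ⟨G, hG, hGI⟩ := ih (hinj.mono (Set.subset_insert _ _))
    refine ⟨_, ite_eq (hH i) hG hc (he i), ?_⟩
    intro j hj a ha
    by_cases hij : j = i
    · subst hij
      simp [ha]
    · have hne : e j ≠ e i := fun h => hij (hinj hj (Set.mem_insert _ _) h)
      have hjI : j ∈ I := hj.resolve_left hij
      simp only [ha, if_neg hne]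
      exact hGI j hjI a ha

theorem Unary.exists_cases {ι : Type*} {I : Set ι} (hI : I.Finite) {e : ι → ZFSet.{u}}
    (he : ∀ i, Unary (fun _ => e i)) (hinj : I.InjOn e) {g : ZFSet.{u} → ZFSet.{u}} (hg : Unary g)
    {H : ι → ZFSet.{u} → ZFSet.{u}} (hH : ∀ i, Unary (H i)) :
    ∃ G, Unary G ∧ ∀ i ∈ I, ∀ z, g z = e i → G z = H i z := by
  obtain ⟨G, hG, h⟩ := PCSFMinus.exists_cases hI he hinj hg hH
  refine ⟨fun z => G (fun _ => z), ?_, fun i hi z hz => h i hi _ hz⟩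
  exact comp (t := fun _ a => a 0) hG (fun _ => proj 0)

end PCSFMinus

/-! ### Composition and set recursion in `PCSF`. -/

namespace PCSF

/-- Functions of `PCSF` without safe arguments. -/
def Normal {n : ℕ} (r : (Fin n → ZFSet.{u}) → ZFSet.{u}) : Prop :=
  PCSF (fun x (_ : Fin 0 → ZFSet.{u}) => r x)

variable {n : ℕ}

theorem normal_proj (j : Fin n) : Normal (fun x : Fin n → ZFSet.{u} => x j) :=
  projNormal j

theorem Normal.comp {k l : ℕ} {h : (Fin k → ZFSet.{u}) → (Fin l → ZFSet.{u}) → ZFSet.{u}}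
    (hh : PCSF h) {r : Fin k → (Fin n → ZFSet.{u}) → ZFSet.{u}} (hr : ∀ i, Normal (r i))
    {t : Fin l → (Fin n → ZFSet.{u}) → ZFSet.{u}} (ht : ∀ i, Normal (t i)) :
    Normal (fun x => h (fun i => r i x) (fun i => t i x)) :=
  PCSF.comp (r := fun i x _ => r i x) (t := fun i x _ => t i x) hh hr ht

/-- Function application of a `PCSF⁻` function to safe and normal arguments. -/
theorem ofMinus_comp {m l : ℕ} {g : (Fin l → ZFSet.{u}) → ZFSet.{u}} (hg : PCSFMinus g)
    {t : Fin l → (Fin n → ZFSet.{u}) → (Fin m → ZFSet.{u}) → ZFSet.{u}} (ht : ∀ j, PCSF (t j)) :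
    PCSF (fun x a => g (fun j => t j x a)) :=
  PCSF.comp (r := fun i : Fin 0 => i.elim0) (ofMinus hg) (fun i => i.elim0) ht

theorem Normal.ofMinus {l : ℕ} {g : (Fin l → ZFSet.{u}) → ZFSet.{u}} (hg : PCSFMinus g)
    {t : Fin l → (Fin n → ZFSet.{u}) → ZFSet.{u}} (ht : ∀ i, Normal (t i)) :
    Normal (fun x => g (fun i => t i x)) :=
  ofMinus_comp hg ht

theorem Normal.unary {g : ZFSet.{u} → ZFSet.{u}} (hg : PCSFMinus.Unary g)
    {r : (Fin n → ZFSet.{u}) → ZFSet.{u}} (hr : Normal r) : Normal (fun x => g (r x)) :=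
  Normal.ofMinus hg (t := fun _ => r) (fun _ => hr)

theorem Normal.kpair {r t : (Fin n → ZFSet.{u}) → ZFSet.{u}} (hr : Normal r) (ht : Normal t) :
    Normal (fun x => ZFSet.pair (r x) (t x)) :=
  Normal.ofMinus (PCSFMinus.kpair_of (PCSFMinus.proj 0) (PCSFMinus.proj 1)) (t := ![r, t])
    (Fin.forall_fin_two.2 ⟨hr, ht⟩)

/-- The function defined by predicative set recursion from `h` exists. -/
theorem exists_setRec {m : ℕ}
    {h : (Fin (n + 1) → ZFSet.{u}) → (Fin (m + 1) → ZFSet.{u}) → ZFSet.{u}} (hh : PCSF h) :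
    ∃ f : (Fin (n + 1) → ZFSet.{u}) → (Fin m → ZFSet.{u}) → ZFSet.{u}, PCSF f ∧
      ∀ x y a, f (Fin.cons x y) a =
        h (Fin.cons x y) (Fin.snoc (α := fun _ => ZFSet.{u}) a
          (ZFSet.range (fun z : {z : ZFSet.{u} // z ∈ x} => f (Fin.cons z.1 y) a))) := by
  let φ : (Fin n → ZFSet.{u}) → (Fin m → ZFSet.{u}) → ZFSet.{u} → ZFSet.{u} := fun y a =>
    ZFSet.mem_wf.fix (fun x ih => h (Fin.cons x y) (Fin.snoc (α := fun _ => ZFSet.{u}) a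
      (ZFSet.range (fun z : {z : ZFSet.{u} // z ∈ x} => ih z.1 z.2))))
  have hφ : ∀ x y a, φ y a x = h (Fin.cons x y) (Fin.snoc (α := fun _ => ZFSet.{u}) a
      (ZFSet.range (fun z : {z : ZFSet.{u} // z ∈ x} => φ y a z.1))) :=
    fun x y a => ZFSet.mem_wf.fix_eq _ x
  let F : (Fin (n + 1) → ZFSet.{u}) → (Fin m → ZFSet.{u}) → ZFSet.{u} :=
    fun v a => φ (Fin.tail v) a (v 0)
  have key : ∀ x y a, F (Fin.cons x y) a =
        h (Fin.cons x y) (Fin.snoc (α := fun _ => ZFSet.{u}) a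
          (ZFSet.range (fun z : {z : ZFSet.{u} // z ∈ x} => F (Fin.cons z.1 y) a))) := by
    intro x y a
    simpa [F] using hφ x y a
  exact ⟨F, setRec hh key, key⟩

/-- Set recursion on a single normal argument, without parameters. -/
theorem exists_rec {H : ZFSet.{u} → ZFSet.{u}} (hH : PCSFMinus.Unary H) :
    ∃ f : ZFSet.{u} → ZFSet.{u}, (∀ {n : ℕ} {r : (Fin n → ZFSet.{u}) → ZFSet.{u}},
        Normal r → Normal (fun x => f (r x))) ∧
      ∀ x, f x = H (ZFSet.range (fun z : {z : ZFSet.{u} // z ∈ x} => f z.1)) := by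
  obtain ⟨f, hf, hrec⟩ := exists_setRec (n := 0) (m := 0) (h := fun _ a => H (a 0))
    (ofMinus_comp hH (t := fun j _ a => a j) (fun j => projSafe j))
  have e : ∀ x : ZFSet.{u}, (Fin.cons x Fin.elim0 : Fin 1 → ZFSet.{u}) = fun _ => x := by
    intro x
    funext i
    fin_cases i
    rfl
  refine ⟨fun x => f (fun _ => x) Fin.elim0, fun {n r} hr => ?_, fun x => ?_⟩
  · have := Normal.comp hf (r := fun _ => r) (t := Fin.elim0) (fun _ => hr) (fun i => i.elim0)
    convert this using 3
  · have := hrec x Fin.elim0 Fin.elim0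
    simp only [e] at this
    exact this

end PCSF

/-! ### Numerals and rank. -/

/-- The Zermelo numerals `∅, {∅}, {{∅}}, …`. -/
noncomputable def zermelo : ℕ → ZFSet.{u}
  | 0 => ∅
  | n + 1 => {zermelo n}

/-- The von Neumann numerals. -/
noncomputable def vonNeumannNat : ℕ → ZFSet.{u}
  | 0 => ∅
  | n + 1 => insert (vonNeumannNat n) (vonNeumannNat n)

theorem zermelo_injective : Function.Injective zermelo.{u} := by
  intro a
  induction a with
  | zero =>
    rintro (_ | b) h
    · rfl
    · exact absurd h.symm (zsingleton_ne_empty _)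
  | succ a ih =>
    rintro (_ | b) h
    · exact absurd h (zsingleton_ne_empty _)
    · exact congrArg _ (ih (ZFSet.singleton_injective h))

theorem mem_vonNeumannNat {n : ℕ} {z : ZFSet.{u}} :
    z ∈ vonNeumannNat n ↔ ∃ m < n, z = vonNeumannNat m := by
  induction n with
  | zero => simp [vonNeumannNat]
  | succ n ih =>
    rw [vonNeumannNat, ZFSet.mem_insert_iff, ih]
    constructor
    · rintro (h | ⟨m, hm, h⟩)
      · exact ⟨n, n.lt_succ_self, h⟩
      · exact ⟨m, hm.trans n.lt_succ_self, h⟩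
    · rintro ⟨m, hm, h⟩
      rcases (Nat.lt_succ_iff_lt_or_eq.1 hm) with h' | rfl
      · exact Or.inr ⟨m, h', h⟩
      · exact Or.inl h

namespace PCSFMinus

theorem zermelo {m : ℕ} (k : ℕ) : PCSFMinus (fun _ : Fin m → ZFSet.{u} => zermelo k) := by
  induction k with
  | zero => exact empty
  | succ k ih => exact singleton_of ih

end PCSFMinus

/-- `HasRank x n` says that `x` is built from the empty set by unordered pairing, with rank `n`. -/
inductive HasRank : ZFSet.{u} → ℕ → Prop
  | empty : HasRank ∅ 0
  | pair {a b : ZFSet.{u}} {i j : ℕ} : HasRank a i → HasRank b j → HasRank {a, b} (max i j + 1)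

namespace HasRank

theorem singleton {a : ZFSet.{u}} {i : ℕ} (h : HasRank a i) : HasRank {a} (i + 1) := by
  have := pair h h
  rwa [max_self, show ({a, a} : ZFSet.{u}) = {a} by ext; simp] at this

theorem kpair {a b : ZFSet.{u}} {i j : ℕ} (ha : HasRank a i) (hb : HasRank b j) :
    HasRank (ZFSet.pair a b) (max i j + 2) := by
  have := pair ha.singleton (pair ha hb)
  rwa [show max (i + 1) (max i j + 1) + 1 = max i j + 2 by omega] at this

theorem zermelo : ∀ n, HasRank (zermelo.{u} n) n
  | 0 => empty
  | n + 1 => (zermelo n).singleton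

end HasRank

namespace PCSF

/-- There is a function of `PCSF` sending each set of rank `n` to the Zermelo numeral of `n`. -/
theorem exists_rank : ∃ ρ : ZFSet.{u} → ZFSet.{u},
    (∀ {n : ℕ} {r : (Fin n → ZFSet.{u}) → ZFSet.{u}}, Normal r → Normal (fun x => ρ (r x))) ∧
    ∀ x n, HasRank x n → ρ x = zermelo n := by
  -- `f` is the von Neumann rank: if `S` is the set of ranks of the elements, `S ∪ ⋃ S` is the least
  -- ordinal above all of them.
  obtain ⟨f, hf, hfx⟩ := exists_rec (H := fun S : ZFSet.{u} => S ∪ ZFSet.sUnion S)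
    (PCSFMinus.union_of PCSFMinus.proj_zero (PCSFMinus.sUnion_of PCSFMinus.proj_zero))
  -- `g` turns von Neumann numerals into Zermelo numerals `z_n`: from `S = {z_0, …, z_(n-1)}` one
  -- gets `⋃ S = {z_0, …, z_(n-2)}`, and the difference is `{z_(n-1)} = z_n`.
  obtain ⟨g, hg, hgx⟩ := exists_rec (H := fun S : ZFSet.{u} => S \ ZFSet.sUnion S)
    (PCSFMinus.sdiff_of PCSFMinus.proj_zero (PCSFMinus.sUnion_of PCSFMinus.proj_zero))
  have hgn : ∀ n, g (vonNeumannNat n) = zermelo n := by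
    intro n
    induction n using Nat.strong_induction_on with
    | _ n ih =>
      have hS : ∀ w, w ∈ ZFSet.range
          (fun z : {z : ZFSet.{u} // z ∈ vonNeumannNat n} => g z.1) ↔ ∃ m < n, w = zermelo m := by
        intro w
        simp only [ZFSet.mem_range, Subtype.exists, mem_vonNeumannNat]
        constructor
        · rintro ⟨_, ⟨m, hm, rfl⟩, rfl⟩
          exact ⟨m, hm, ih m hm⟩
        · rintro ⟨m, hm, rfl⟩
          exact ⟨_, ⟨m, hm, rfl⟩, ih m hm⟩
      rw [hgx]
      ext w
      simp only [ZFSet.mem_sdiff, ZFSet.mem_sUnion, hS]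
      cases n with
      | zero => simp [zermelo]
      | succ n =>
        rw [zermelo, ZFSet.mem_singleton]
        constructor
        · rintro ⟨⟨m, hm, rfl⟩, h⟩
          rcases Nat.lt_succ_iff_lt_or_eq.1 hm with h' | rfl
          · exact absurd ⟨_, ⟨m + 1, Nat.succ_lt_succ h', rfl⟩, ZFSet.mem_singleton.2 rfl⟩ h
          · rfl
        · rintro rfl
          refine ⟨⟨n, n.lt_succ_self, rfl⟩, ?_⟩
          rintro ⟨_, ⟨m, hm, rfl⟩, h⟩
          cases m with
          | zero => exact ZFSet.notMem_empty _ h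
          | succ m =>
            have := zermelo_injective (ZFSet.mem_singleton.1 h)
            omega
  refine ⟨fun x => g (f x), fun hr => hg (hf hr), fun x n h => ?_⟩
  suffices hx : f x = vonNeumannNat n by
    change g (f x) = _
    rw [hx, hgn]
  induction h with
  | empty =>
    rw [hfx]
    ext w
    simp [vonNeumannNat, ZFSet.mem_sUnion]
  | @pair a b i j _ _ ha hb =>
    rw [hfx]
    ext w
    simp only [ZFSet.mem_union, ZFSet.mem_sUnion, ZFSet.mem_range, Subtype.exists, ZFSet.mem_pair,
      mem_vonNeumannNat]
    constructor
    · rintro (⟨_, rfl | rfl, rfl⟩ | ⟨_, ⟨_, rfl | rfl, rfl⟩, h⟩)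
      · exact ⟨i, by omega, ha⟩
      · exact ⟨j, by omega, hb⟩
      · rw [ha, mem_vonNeumannNat] at h
        obtain ⟨m, hm, rfl⟩ := h
        exact ⟨m, by omega, rfl⟩
      · rw [hb, mem_vonNeumannNat] at h
        obtain ⟨m, hm, rfl⟩ := h
        exact ⟨m, by omega, rfl⟩
    · rintro ⟨m, hm, rfl⟩
      by_cases h1 : m < i
      · exact Or.inr ⟨f a, ⟨a, Or.inl rfl, rfl⟩, by rw [ha, mem_vonNeumannNat]; exact ⟨m, h1, rfl⟩⟩
      by_cases h2 : m < j
      · exact Or.inr ⟨f b, ⟨b, Or.inr rfl, rfl⟩, by rw [hb, mem_vonNeumannNat]; exact ⟨m, h2, rfl⟩⟩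
      rcases (by omega : m = i ∨ m = j) with rfl | rfl
      · exact Or.inl ⟨a, Or.inl rfl, ha⟩
      · exact Or.inl ⟨b, Or.inr rfl, hb⟩

/-! ### Iteration and arithmetic along Zermelo numerals. -/

/-- Iteration of a function of `PCSF` along a Zermelo numeral. -/
theorem exists_iterate {h : ZFSet.{u} → ZFSet.{u} → ZFSet.{u}}
    (hh : PCSF (fun (x : Fin 1 → ZFSet.{u}) (a : Fin 1 → ZFSet.{u}) => h (x 0) (a 0))) :
    ∃ M : ZFSet.{u} → ZFSet.{u} → ZFSet.{u} → ZFSet.{u},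
      PCSF (fun (x : Fin 2 → ZFSet.{u}) (a : Fin 1 → ZFSet.{u}) => M (x 0) (x 1) (a 0)) ∧
      ∀ N y c, M (zermelo N) y c = (h y)^[N] c := by
  classical
  -- `v 1` is the set of recursive values; over a successor numeral it is a singleton, and union
  -- extracts its element. `v 0` is the starting value.
  have h1 : PCSF (fun (x : Fin 2 → ZFSet.{u}) (v : Fin 2 → ZFSet.{u}) =>
      h (x 1) (ZFSet.sUnion (v 1))) :=
    PCSF.comp (r := fun _ x _ => x 1) (t := fun _ _ v => ZFSet.sUnion (v 1)) hh
      (fun _ => projNormal 1)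
      (fun _ => ofMinus_comp PCSFMinus.union (t := fun _ _ v => v 1) (fun _ => projSafe 1))
  have h2 : PCSF (fun (x : Fin 2 → ZFSet.{u}) (v : Fin 2 → ZFSet.{u}) =>
      if ∅ = x 0 then v 0 else h (x 1) (ZFSet.sUnion (v 1))) :=
    ofMinus_comp (l := 3) (PCSFMinus.ite_eq (PCSFMinus.proj 0) (PCSFMinus.proj 1)
      PCSFMinus.empty (PCSFMinus.proj 2))
      (t := ![fun _ v => v 0, fun x v => h (x 1) (ZFSet.sUnion (v 1)), fun x _ => x 0])
      (by
        intro j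
        fin_cases j
        · exact projSafe 0
        · exact h1
        · exact projNormal 0)
  obtain ⟨f, hf, hrec⟩ := exists_setRec (n := 1) (m := 1) h2
  have e : ∀ x y : ZFSet.{u}, (Fin.cons x (fun _ => y) : Fin 2 → ZFSet.{u}) = ![x, y] := by
    intro x y
    funext i
    fin_cases i <;> rfl
  have key : ∀ x y c : ZFSet.{u}, f ![x, y] ![c] = if ∅ = x then c else
      h y (ZFSet.sUnion (ZFSet.range (fun z : {z : ZFSet.{u} // z ∈ x} => f ![z.1, y] ![c]))) := by
    intro x y c
    have := hrec x (fun _ => y) ![c]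
    simp only [e] at this
    exact this
  refine ⟨fun x y c => f ![x, y] ![c], ?_, ?_⟩
  · convert hf using 3 with x a
    change f ![x 0, x 1] ![a 0] = f x a
    congr 1
    · funext i; fin_cases i <;> rfl
    · funext i; fin_cases i; rfl
  · intro N y c
    beta_reduce
    induction N with
    | zero => rw [key]; simp [zermelo]
    | succ N ih =>
      rw [key, zermelo, if_neg (zsingleton_ne_empty _).symm, Function.iterate_succ_apply', ← ih]
      congr 1
      ext w
      simp [ZFSet.mem_sUnion]

theorem exists_iterate_unary {g : ZFSet.{u} → ZFSet.{u}} (hg : PCSFMinus.Unary g) :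
    ∃ M : ZFSet.{u} → ZFSet.{u} → ZFSet.{u},
      PCSF (fun (x : Fin 1 → ZFSet.{u}) (a : Fin 1 → ZFSet.{u}) => M (x 0) (a 0)) ∧
      ∀ N c, M (zermelo N) c = g^[N] c := by
  obtain ⟨M, hM, h⟩ := exists_iterate (h := fun _ => g)
    (ofMinus_comp hg (t := fun _ _ a => a 0) (fun _ => projSafe 0))
  refine ⟨fun x c => M x x c, ?_, fun N c => h N _ c⟩
  exact PCSF.comp (r := fun _ x _ => x 0) (t := fun _ _ a => a 0) hM (fun _ => projNormal 0)
      (fun _ => projSafe 0)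

/-- Iterated singleton formation. The second summand stays safe, so adding a fixed normal number can
itself be iterated. -/
theorem exists_add : ∃ A : ZFSet.{u} → ZFSet.{u} → ZFSet.{u},
    PCSF (fun (x : Fin 1 → ZFSet.{u}) (a : Fin 1 → ZFSet.{u}) => A (x 0) (a 0)) ∧
    ∀ i j, A (zermelo i) (zermelo j) = zermelo (i + j) := by
  obtain ⟨M, hM, h⟩ := exists_iterate_unary (g := fun z => {z})
    (PCSFMinus.singleton_of PCSFMinus.proj_zero)
  refine ⟨M, hM, fun i j => ?_⟩
  rw [h]
  induction i with
  | zero => simp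
  | succ i ih => rw [Function.iterate_succ_apply', ih, Nat.succ_add]; rfl

/-- Repeated addition starting from `∅`. Both factors are normal and there is no safe argument, so
products may again be used in normal position. -/
theorem exists_mul : ∃ B : ZFSet.{u} → ZFSet.{u} → ZFSet.{u},
    PCSF (fun (x : Fin 2 → ZFSet.{u}) (_ : Fin 0 → ZFSet.{u}) => B (x 0) (x 1)) ∧
    ∀ i j, B (zermelo i) (zermelo j) = zermelo (i * j) := by
  obtain ⟨A, hA, hadd⟩ := exists_add.{u}
  obtain ⟨M, hM, h⟩ := exists_iterate hA
  refine ⟨fun x y => M x y ∅, ?_, fun i j => ?_⟩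
  · exact PCSF.comp (r := fun i x _ => x i) (t := fun _ _ _ => ∅) hM (fun i => projNormal i)
      (fun _ => ofMinus_comp PCSFMinus.null (t := fun j => j.elim0) (fun j => j.elim0))
  · beta_reduce
    rw [h]
    induction i with
    | zero => simp [zermelo]
    | succ i ih => rw [Function.iterate_succ_apply', ih, hadd, Nat.succ_mul, add_comm]

/-- Polynomials with natural number coefficients act on Zermelo numerals within `PCSF`. -/
theorem exists_polynomial (p : Polynomial ℕ) : ∃ P : ZFSet.{u} → ZFSet.{u},
    (∀ {n : ℕ} {r : (Fin n → ZFSet.{u}) → ZFSet.{u}}, Normal r → Normal (fun x => P (r x))) ∧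
    ∀ i, P (zermelo i) = zermelo (p.eval i) := by
  obtain ⟨A, hA, hadd⟩ := exists_add.{u}
  obtain ⟨B, hB, hmul⟩ := exists_mul.{u}
  have hC : ∀ (k : ℕ) {n : ℕ}, Normal (fun _ : Fin n → ZFSet.{u} => zermelo k) := fun k n =>
    Normal.ofMinus (PCSFMinus.zermelo (m := 0) k) (t := fun j => j.elim0) (fun j => j.elim0)
  induction p using Polynomial.induction_on with
  | C k => exact ⟨fun _ => zermelo k, fun _ => hC k, by simp⟩
  | add p q hp hq =>
    obtain ⟨P, hP, hp⟩ := hp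
    obtain ⟨Q, hQ, hq⟩ := hq
    refine ⟨fun x => A (P x) (Q x), fun {n r} hr => ?_, fun i => by simp [hp, hq, hadd]⟩
    exact Normal.comp hA (r := fun _ x => P (r x)) (t := fun _ x => Q (r x)) (fun _ => hP hr)
      (fun _ => hQ hr)
  | monomial d k hp =>
    obtain ⟨P, hP, hp⟩ := hp
    refine ⟨fun x => B (P x) x, fun {n r} hr => ?_, fun i => ?_⟩
    · exact Normal.comp hB (r := ![fun x => P (r x), r]) (t := fun j => j.elim0)
        (Fin.forall_fin_two.2 ⟨hP hr, hr⟩) (fun j => j.elim0)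
    · beta_reduce
      rw [hp, hmul]
      simp [pow_succ, mul_assoc]

end PCSF

theorem Polynomial.eval_mono_nat (p : Polynomial ℕ) {i j : ℕ} (h : i ≤ j) :
    p.eval i ≤ p.eval j := by
  simp only [Polynomial.eval_eq_sum, Polynomial.sum]
  gcongr

/-! ### Codes of lists and tuples. -/

/-- The code of a list as an iterated Kuratowski pair, the head being outermost. -/
noncomputable def listCode {α : Type*} (e : α → ZFSet.{u}) : List α → ZFSet.{u}
  | [] => ∅
  | a :: l => ZFSet.pair (e a) (listCode e l)

/-- The code of the restriction of a family to a list of indices. -/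
noncomputable def tupleCode {K : Type*} (s : K → ZFSet.{u}) : List K → ZFSet.{u}
  | [] => ∅
  | k :: ks => ZFSet.pair (s k) (tupleCode s ks)

@[simp] theorem ksnd_listCode {α : Type*} (e : α → ZFSet.{u}) (l : List α) :
    ksnd (listCode e l) = listCode e l.tail := by
  cases l <;> simp [listCode]

@[simp] theorem kfst_listCode {α : Type*} (e : α → ZFSet.{u}) (l : List α) :
    kfst (listCode e l) = l.head?.elim ∅ e := by
  cases l <;> simp [listCode]

theorem PCSFMinus.tupleCode_of {K : Type*} {m : ℕ} {s : K → (Fin m → ZFSet.{u}) → ZFSet.{u}}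
    (hs : ∀ k, PCSFMinus (s k)) (ks : List K) :
    PCSFMinus (fun a => tupleCode (fun k => s k a) ks) := by
  induction ks with
  | nil => exact empty
  | cons k ks ih => exact kpair_of (hs k) ih

/-- The index list is fixed, so the component is reached by a constant number of uses of `ksnd`
followed by `kfst`. -/
theorem exists_unary_component {K : Type*} (ks : List K) (k : K) (hk : k ∈ ks) :
    ∃ g : ZFSet.{u} → ZFSet.{u}, PCSFMinus.Unary g ∧ ∀ s, g (tupleCode s ks) = s k := by
  induction ks with
  | nil => simp at hk
  | cons k' ks ih =>
    by_cases h : k = k'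
    · subst h
      exact ⟨kfst, PCSFMinus.unary_kfst, fun s => by simp [tupleCode]⟩
    · obtain ⟨g, hg, hgs⟩ := ih (by simpa [h] using hk)
      exact ⟨fun z => g (ksnd z), hg.of PCSFMinus.unary_ksnd, fun s => by simp [tupleCode, hgs]⟩

/-! ### Symbols that a stack machine can use. -/

namespace Turing.TM2

variable {K : Type} {Γ : K → Type} {Λ σ : Type}

/-- All symbols pushed by the statement lie in `A`. -/
def Stmt.PushesIn (A : Set (Σ k, Γ k)) : Stmt Γ Λ σ → Prop
  | .push k f q => (∀ v, ⟨k, f v⟩ ∈ A) ∧ q.PushesIn A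
  | .peek _ _ q => q.PushesIn A
  | .pop _ _ q => q.PushesIn A
  | .load _ q => q.PushesIn A
  | .branch _ q₁ q₂ => q₁.PushesIn A ∧ q₂.PushesIn A
  | .goto _ => True
  | .halt => True

theorem Stmt.PushesIn.mono {A B : Set (Σ k, Γ k)} (h : A ⊆ B) {q : Stmt Γ Λ σ}
    (hq : q.PushesIn A) : q.PushesIn B := by
  induction q with
  | push k f q ih => exact ⟨fun v => h (hq.1 v), ih hq.2⟩
  | peek _ _ _ ih | pop _ _ _ ih | load _ _ ih => exact ih hq
  | branch _ _ _ ih₁ ih₂ => exact ⟨ih₁ hq.1, ih₂ hq.2⟩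
  | goto | halt => trivial

/-- A pushed symbol depends only on the internal state, so each push contributes a finite range.
This replaces finiteness of the stack alphabets, which the machine model does not require in
general. -/
theorem Stmt.exists_pushesIn [Finite σ] (q : Stmt Γ Λ σ) :
    ∃ A : Set (Σ k, Γ k), A.Finite ∧ q.PushesIn A := by
  induction q with
  | push k f q ih =>
    obtain ⟨A, hA, h⟩ := ih
    exact ⟨A ∪ Set.range (fun v => ⟨k, f v⟩), hA.union (Set.finite_range _),
      fun v => Or.inr ⟨v, rfl⟩, h.mono Set.subset_union_left⟩
  | peek _ _ _ ih | pop _ _ _ ih | load _ _ ih => exact ih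
  | branch _ _ _ ih₁ ih₂ =>
    obtain ⟨A, hA, h⟩ := ih₁
    obtain ⟨B, hB, h'⟩ := ih₂
    exact ⟨A ∪ B, hA.union hB, h.mono Set.subset_union_left, h'.mono Set.subset_union_right⟩
  | goto | halt => exact ⟨∅, Set.finite_empty, trivial⟩

/-- All symbols on the stacks lie in `A`. -/
def StacksIn (A : Set (Σ k, Γ k)) (S : ∀ k, List (Γ k)) : Prop :=
  ∀ k, ∀ g ∈ S k, ⟨k, g⟩ ∈ A

section

variable [DecidableEq K] {A : Set (Σ k, Γ k)}

theorem StacksIn.push {S : ∀ k, List (Γ k)} (hS : StacksIn A S) {k : K} {g : Γ k}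
    (hg : ⟨k, g⟩ ∈ A) : StacksIn A (Function.update S k (g :: S k)) := by
  intro k' g' h
  by_cases hk : k' = k
  · subst hk
    rw [Function.update_self, List.mem_cons] at h
    rcases h with rfl | h
    · exact hg
    · exact hS _ _ h
  · rw [Function.update_of_ne hk] at h
    exact hS _ _ h

theorem StacksIn.pop {S : ∀ k, List (Γ k)} (hS : StacksIn A S) (k : K) :
    StacksIn A (Function.update S k (S k).tail) := by
  intro k' g' h
  by_cases hk : k' = k
  · subst hk
    rw [Function.update_self] at h
    exact hS _ _ (List.mem_of_mem_tail h)
  · rw [Function.update_of_ne hk] at h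
    exact hS _ _ h

theorem StacksIn.stepAux {q : Stmt Γ Λ σ} (hq : q.PushesIn A) (v : σ) {S : ∀ k, List (Γ k)}
    (hS : StacksIn A S) : StacksIn A (TM2.stepAux q v S).stk := by
  induction q generalizing v S with
  | push k f q ih => exact ih hq.2 _ (hS.push (hq.1 v))
  | peek k f q ih => exact ih hq _ hS
  | pop k f q ih => exact ih hq _ (hS.pop k)
  | load f q ih => exact ih hq _ hS
  | branch f q₁ q₂ ih₁ ih₂ =>
    rw [TM2.stepAux]
    cases f v
    · exact ih₂ hq.2 _ hS
    · exact ih₁ hq.1 _ hS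
  | goto | halt => exact hS

end

/-! ### Simulation of a step on coded configurations. -/

/-- Codes for the labels, the internal states and the symbols of a machine as Zermelo numerals. -/
structure Coding (Γ : K → Type) (Λ σ : Type) where
  /-- the code of a label, or of the halting state -/
  label : Option Λ → ℕ
  /-- the code of an internal state -/
  state : σ → ℕ
  /-- the code of a stack symbol, less one -/
  symbol : (Σ k, Γ k) → ℕ
  /-- the symbols in use -/
  alphabet : Set (Σ k, Γ k)
  label_injective : Function.Injective label
  state_injective : Function.Injective state
  symbol_injOn : alphabet.InjOn symbol
  finite_alphabet : alphabet.Finite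

namespace Coding

variable (C : Coding Γ Λ σ)

theorem exists_of_finite [Finite Λ] [Finite σ] {A : Set (Σ k, Γ k)} (hA : A.Finite) :
    ∃ C : Coding Γ Λ σ, C.alphabet = A := by
  obtain ⟨l, hl⟩ := Countable.exists_injective_nat (Option Λ)
  obtain ⟨s, hs⟩ := Countable.exists_injective_nat σ
  obtain ⟨g, hg⟩ := Set.countable_iff_exists_injOn.1 hA.countable
  exact ⟨⟨l, s, g, A, hl, hs, hg, hA⟩, rfl⟩

/-- The code of a symbol on the stack `k`. -/
noncomputable def symbolCode (k : K) (g : Γ k) : ZFSet.{u} := zermelo (C.symbol ⟨k, g⟩ + 1)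

/-- The code of the internal state and the stacks. -/
noncomputable def storeCode (ks : List K) (v : σ) (S : ∀ k, List (Γ k)) : ZFSet.{u} :=
  ZFSet.pair (zermelo (C.state v)) (tupleCode (fun k => listCode (C.symbolCode k) (S k)) ks)

/-- The code of a configuration. -/
noncomputable def cfgCode (ks : List K) (c : Cfg Γ Λ σ) : ZFSet.{u} :=
  ZFSet.pair (zermelo (C.label c.l)) (C.storeCode ks c.var c.stk)

theorem ksnd_ksnd_cfgCode (ks : List K) (c : Cfg Γ Λ σ) : ksnd (ksnd (C.cfgCode.{u} ks c)) =
    tupleCode (fun k => listCode (C.symbolCode k) (c.stk k)) ks := by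
  simp [cfgCode, storeCode]

/-- Allows the state to be treated as a constant when the effect of a statement is coded. -/
theorem exists_state_cases [Finite σ] (ks : List K) {H : σ → ZFSet.{u} → ZFSet.{u}}
    (hH : ∀ v, PCSFMinus.Unary (H v)) : ∃ G, PCSFMinus.Unary G ∧
      ∀ v S, G (C.storeCode ks v S) = H v (C.storeCode ks v S) := by
  obtain ⟨G, hG, h⟩ := PCSFMinus.Unary.exists_cases (I := Set.univ) Set.finite_univ
    (e := fun v => zermelo (C.state v)) (fun v => PCSFMinus.zermelo _)
    (fun v _ w _ h => C.state_injective (zermelo_injective h)) PCSFMinus.unary_kfst hH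
  exact ⟨G, hG, fun v S => h v trivial _ (by simp [storeCode])⟩

/-- Symbol codes are successor numerals, hence nonempty, so the value `kfst ∅ = ∅` marks the empty
stack. The stack invariant leaves only finitely many possible heads. -/
theorem exists_head_cases [Finite σ] {ks : List K} {k : K} (hk : k ∈ ks)
    {H : σ → Option (Γ k) → ZFSet.{u} → ZFSet.{u}} (hH : ∀ v o, PCSFMinus.Unary (H v o)) :
    ∃ G, PCSFMinus.Unary G ∧ ∀ v S, StacksIn C.alphabet S →
      G (C.storeCode ks v S) = H v (S k).head? (C.storeCode ks v S) := by
  obtain ⟨π, hπ, hπs⟩ := exists_unary_component.{u} ks k hk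
  have hfin : (insert none (some '' (Sigma.mk k ⁻¹' C.alphabet)) : Set (Option (Γ k))).Finite :=
    ((C.finite_alphabet.preimage sigma_mk_injective.injOn).image _).insert _
  have hinj : (insert none (some '' (Sigma.mk k ⁻¹' C.alphabet)) : Set (Option (Γ k))).InjOn
      (fun o => (o.elim ∅ (C.symbolCode k) : ZFSet.{u})) := by
    rintro _ (rfl | ⟨a, ha, rfl⟩) _ (rfl | ⟨b, hb, rfl⟩) h
    · rfl
    · exact absurd h.symm (zsingleton_ne_empty _)
    · exact absurd h (zsingleton_ne_empty _)
    · have := C.symbol_injOn ha hb (Nat.succ_injective (zermelo_injective h))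
      rw [sigma_mk_injective this]
  have h1 := fun v => PCSFMinus.Unary.exists_cases hfin
    (e := fun o => (o.elim ∅ (C.symbolCode k) : ZFSet.{u}))
    (by rintro (_ | g); exacts [PCSFMinus.empty, PCSFMinus.zermelo _]) hinj
    (g := fun z => kfst (π (ksnd z)))
    (PCSFMinus.kfst_of (hπ.of PCSFMinus.unary_ksnd)) (hH v)
  choose G hG hGH using h1
  obtain ⟨F, hF, hFG⟩ := C.exists_state_cases ks hG
  refine ⟨F, hF, fun v S hS => ?_⟩
  rw [hFG]
  refine hGH v _ ?_ _ (by simp [storeCode, hπs])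
  cases h : (S k).head? with
  | none => exact Or.inl rfl
  | some g => exact Or.inr ⟨g, hS k g (List.mem_of_mem_head? h), rfl⟩

theorem exists_setState (ks : List K) (w : σ) : ∃ G, PCSFMinus.Unary G ∧
    ∀ v S, G (C.storeCode.{u} ks v S) = C.storeCode ks w S :=
  ⟨fun z => ZFSet.pair (zermelo (C.state w)) (ksnd z),
    PCSFMinus.kpair_of (PCSFMinus.zermelo _) PCSFMinus.unary_ksnd,
    fun v S => by simp [storeCode]⟩

variable [DecidableEq K]

/-- The tuple is rebuilt component by component, with `g` applied at the index `k` only. -/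
theorem exists_update {ks : List K} (hks : ∀ k, k ∈ ks) (k : K)
    {g : ZFSet.{u} → ZFSet.{u}} (hg : PCSFMinus.Unary g) {f : List (Γ k) → List (Γ k)}
    (hgf : ∀ l, g (listCode (C.symbolCode k) l) = listCode (C.symbolCode k) (f l)) :
    ∃ G, PCSFMinus.Unary G ∧ ∀ v S, G (C.storeCode.{u} ks v S) =
      C.storeCode ks v (Function.update S k (f (S k))) := by
  choose π hπ hπs using fun k => exists_unary_component.{u} ks k (hks k)
  refine ⟨fun z => ZFSet.pair (kfst z)
    (tupleCode (fun k' => if k' = k then g (π k' (ksnd z)) else π k' (ksnd z)) ks), ?_, ?_⟩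
  · refine PCSFMinus.kpair_of PCSFMinus.unary_kfst (PCSFMinus.tupleCode_of (fun k' => ?_) ks)
    split_ifs
    · exact hg.of ((hπ k').of PCSFMinus.unary_ksnd)
    · exact (hπ k').of PCSFMinus.unary_ksnd
  · intro v S
    simp only [storeCode, kfst_pair, ksnd_pair, hπs]
    congr 2
    funext k'
    split_ifs with h
    · subst h
      rw [hgf, Function.update_self]
    · rw [Function.update_of_ne h]

/-- The effect of a statement on codes of configurations is in `PCSF⁻`. -/
theorem exists_stepAux [Finite σ] {ks : List K} (hks : ∀ k, k ∈ ks) {q : Stmt Γ Λ σ}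
    (hq : q.PushesIn C.alphabet) : ∃ G, PCSFMinus.Unary G ∧ ∀ v S, StacksIn C.alphabet S →
      G (C.storeCode.{u} ks v S) = C.cfgCode ks (stepAux q v S) := by
  choose W hW hWs using C.exists_setState.{u} ks
  induction q with
  | push k f q ih =>
    obtain ⟨G, hG, hGs⟩ := ih hq.2
    choose U hU hUs using fun v => C.exists_update.{u} hks k
      (g := fun z => ZFSet.pair (C.symbolCode k (f v)) z) (f := fun l => f v :: l)
      (PCSFMinus.kpair_of (PCSFMinus.zermelo _) PCSFMinus.proj_zero) (fun l => rfl)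
    obtain ⟨F, hF, hFs⟩ := C.exists_state_cases ks (fun v => hG.compose (hU v))
    exact ⟨F, hF, fun v S hS => by
      rw [hFs, hUs, hGs _ _ (hS.push (hq.1 v)), TM2.stepAux]⟩
  | peek k f q ih =>
    obtain ⟨G, hG, hGs⟩ := ih hq
    obtain ⟨F, hF, hFs⟩ := C.exists_head_cases (hks k) (fun v o => hG.compose (hW (f v o)))
    exact ⟨F, hF, fun v S hS => by rw [hFs _ _ hS, hWs, hGs _ _ hS, TM2.stepAux]⟩
  | pop k f q ih =>
    obtain ⟨G, hG, hGs⟩ := ih hq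
    obtain ⟨U, hU, hUs⟩ := C.exists_update.{u} hks k PCSFMinus.unary_ksnd (f := List.tail)
      (fun l => ksnd_listCode _ l)
    obtain ⟨F, hF, hFs⟩ := C.exists_head_cases (hks k)
      (fun v o => hG.compose ((hW (f v o)).compose hU))
    exact ⟨F, hF, fun v S hS => by
      rw [hFs _ _ hS, hUs, hWs, hGs _ _ (hS.pop k), TM2.stepAux]⟩
  | load f q ih =>
    obtain ⟨G, hG, hGs⟩ := ih hq
    obtain ⟨F, hF, hFs⟩ := C.exists_state_cases ks (fun v => hG.compose (hW (f v)))
    exact ⟨F, hF, fun v S hS => by rw [hFs, hWs, hGs _ _ hS, TM2.stepAux]⟩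
  | branch f q₁ q₂ ih₁ ih₂ =>
    obtain ⟨G₁, hG₁, h₁⟩ := ih₁ hq.1
    obtain ⟨G₂, hG₂, h₂⟩ := ih₂ hq.2
    obtain ⟨F, hF, hFs⟩ := C.exists_state_cases ks
      (H := fun v => if f v then G₁ else G₂) (fun v => by split_ifs <;> assumption)
    refine ⟨F, hF, fun v S hS => ?_⟩
    rw [hFs, TM2.stepAux]
    cases f v
    · exact h₂ _ _ hS
    · exact h₁ _ _ hS
  | goto f =>
    obtain ⟨F, hF, hFs⟩ := C.exists_state_cases ks
      (H := fun v z => ZFSet.pair (zermelo (C.label (some (f v)))) z)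
      (fun v => PCSFMinus.kpair_of (PCSFMinus.zermelo _) PCSFMinus.proj_zero)
    exact ⟨F, hF, fun v S hS => by rw [hFs]; rfl⟩
  | halt =>
    exact ⟨fun z => ZFSet.pair (zermelo (C.label none)) z,
      PCSFMinus.kpair_of (PCSFMinus.zermelo _) PCSFMinus.proj_zero, fun v S hS => rfl⟩

/-- The step function, made total by letting halted configurations rest, is in `PCSF⁻`. -/
theorem exists_step [Finite σ] [Finite Λ] {ks : List K} (hks : ∀ k, k ∈ ks)
    {M : Λ → Stmt Γ Λ σ} (hM : ∀ l, (M l).PushesIn C.alphabet) :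
    ∃ G, PCSFMinus.Unary G ∧ ∀ c : Cfg Γ Λ σ, StacksIn C.alphabet c.stk →
      G (C.cfgCode.{u} ks c) = C.cfgCode ks ((step M c).getD c) := by
  choose G hG hGs using fun l => C.exists_stepAux.{u} hks (hM l)
  obtain ⟨F, hF, hFs⟩ := PCSFMinus.Unary.exists_cases (I := Set.univ) Set.finite_univ
    (e := fun o => zermelo.{u} (C.label o)) (fun o => PCSFMinus.zermelo _)
    (fun v _ w _ h => C.label_injective (zermelo_injective h)) PCSFMinus.unary_kfst
    (H := fun o z => o.elim z (fun l => G l (ksnd z))) (by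
      rintro (_ | l)
      · exact PCSFMinus.proj_zero
      · exact (hG l).of PCSFMinus.unary_ksnd)
  refine ⟨F, hF, ?_⟩
  rintro ⟨_ | l, v, S⟩ hS
  · rw [hFs none trivial _ (by simp [cfgCode])]
    rfl
  · rw [hFs (some l) trivial _ (by simp [cfgCode])]
    simpa [cfgCode] using hGs l v S hS

/-- The one-step simulation is valid only while all stack symbols lie in the alphabet; the induction
goes through because steps preserve this. -/
theorem exists_steps [Finite σ] [Finite Λ] {ks : List K} (hks : ∀ k, k ∈ ks)
    {M : Λ → Stmt Γ Λ σ} (hM : ∀ l, (M l).PushesIn C.alphabet) :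
    ∃ G, PCSFMinus.Unary G ∧ ∀ (N : ℕ) (c : Cfg Γ Λ σ), StacksIn C.alphabet c.stk →
      G^[N] (C.cfgCode.{u} ks c) = C.cfgCode ks ((fun c => (step M c).getD c)^[N] c) := by
  obtain ⟨G, hG, hGs⟩ := C.exists_step.{u} hks hM
  refine ⟨G, hG, fun N => ?_⟩
  induction N with
  | zero => exact fun _ _ => rfl
  | succ N ih =>
    rintro ⟨l, v, S⟩ hS
    rw [Function.iterate_succ_apply, Function.iterate_succ_apply, hGs _ hS]
    refine ih _ ?_
    cases l with
    | none => exact hS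
    | some l => exact StacksIn.stepAux (hM l) v hS

end Coding

end Turing.TM2

/-! ### Surplus steps, and conversion of string codes. -/

/-- A run that reaches a terminal value is computed by iterating the totalized step function. -/
theorem iterate_getD_of_iterate_bind {α : Type*} {f : α → Option α} {a b : α} {n N : ℕ}
    (h : (flip Option.bind f)^[n] (some a) = some b) (hb : f b = none) (hN : n ≤ N) :
    (fun c => (f c).getD c)^[N] a = b := by
  have hfix : ∀ k, (fun c => (f c).getD c)^[k] b = b := fun k =>
    Function.iterate_fixed (by simp [hb]) k
  have hnone : ∀ k, (flip Option.bind f)^[k] none = none := fun k =>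
    Function.iterate_fixed rfl k
  have hrun : ∀ n a, (flip Option.bind f)^[n] (some a) = some b →
      (fun c => (f c).getD c)^[n] a = b := by
    intro n
    induction n with
    | zero => intro a h; simpa using h
    | succ n ih =>
      intro a h
      rw [Function.iterate_succ_apply] at h ⊢
      cases hfa : f a with
      | none =>
        rw [show flip Option.bind f (some a) = none from hfa, hnone] at h
        cases h
      | some a' =>
        rw [show flip Option.bind f (some a) = some a' from hfa] at h
        simpa using ih a' h
  obtain ⟨k, rfl⟩ := Nat.exists_eq_add_of_le hN
  rw [add_comm, Function.iterate_add_apply, hrun n a h, hfix]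

theorem listCode_map {α β : Type*} (e : β → ZFSet.{u}) (φ : α → β) (l : List α) :
    listCode e (l.map φ) = listCode (fun a => e (φ a)) l := by
  induction l with
  | nil => rfl
  | cons a l ih => rw [List.map_cons, listCode, listCode, ih]

/-- Each Kuratowski pair has rank at least two above that of the tail, so rank bounds length. Only
this lower bound on the rank is needed of a clock. -/
theorem exists_hasRank_listCode {α : Type*} {e : α → ZFSet.{u}} (he : ∀ a, ∃ i, HasRank (e a) i)
    (l : List α) : ∃ n, l.length ≤ n ∧ HasRank (listCode e l) n := by
  induction l with
  | nil => exact ⟨0, le_rfl, HasRank.empty⟩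
  | cons a l ih =>
    obtain ⟨i, hi⟩ := he a
    obtain ⟨n, hn, h⟩ := ih
    exact ⟨_, by rw [List.length_cons]; omega, hi.kpair h⟩

/-- The last bit is outermost in a string code, whereas the head is outermost in a list code. -/
theorem stringCode_eq_listCode (s : List Bool) :
    stringCode.{u} s = listCode bitCode s.reverse := by
  have h : ∀ s l : List Bool, s.foldl (fun c i => ZFSet.pair (bitCode.{u} i) c)
      (listCode bitCode l) = listCode bitCode (s.reverse ++ l) := by
    intro s
    induction s with
    | nil => exact fun l => rfl
    | cons i s ih =>
      intro l
      rw [List.foldl_cons, List.reverse_cons, List.append_assoc]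
      exact ih (i :: l)
  simpa [listCode, stringCode] using h s []

theorem bitCode_injective : Function.Injective bitCode.{u} := by
  have h : bitCode.{u} false ≠ bitCode true := by
    intro h
    have h1 : ({∅} : ZFSet.{u}) ∈ bitCode false := by
      rw [h]
      simp [bitCode]
    exact zsingleton_ne_empty _ (ZFSet.mem_singleton.1 h1)
  rintro (_ | _) (_ | _) hab
  · rfl
  · exact absurd hab h
  · exact absurd hab.symm h
  · rfl

theorem hasRank_bitCode (b : Bool) : ∃ i, HasRank (bitCode.{u} b) i := by
  cases b
  · exact ⟨_, HasRank.empty.singleton⟩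
  · exact ⟨_, HasRank.empty.pair HasRank.empty.singleton⟩

theorem PCSFMinus.bitCode {m : ℕ} (b : Bool) :
    PCSFMinus (fun _ : Fin m → ZFSet.{u} => bitCode b) := by
  cases b
  · exact singleton_of empty
  · exact pair_of empty (singleton_of empty)

/-- Reversing a coded list onto another one, with a change of alphabet, is in `PCSF`. -/
theorem PCSF.exists_reverseAppend {α β : Type*} [Finite α] {e : α → ZFSet.{u}}
    (he : Function.Injective e) (hec : ∀ a, PCSFMinus.Unary (fun _ => e a))
    (her : ∀ a, ∃ i, HasRank (e a) i) {d : β → ZFSet.{u}}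
    (hd : ∀ b, PCSFMinus.Unary (fun _ => d b)) (φ : α → β) :
    ∃ T : ZFSet.{u} → ZFSet.{u} → ZFSet.{u},
      (∀ {n : ℕ} {r t : (Fin n → ZFSet.{u}) → ZFSet.{u}}, Normal r → Normal t →
        Normal (fun x => T (r x) (t x))) ∧
      ∀ l w, T (listCode e l) (listCode d w) = listCode d ((l.map φ).reverse ++ w) := by
  classical
  obtain ⟨D, hD, hDe⟩ := PCSFMinus.Unary.exists_cases (I := Set.univ) Set.finite_univ hec he.injOn
    PCSFMinus.unary_id (fun a => hd (φ a))
  -- On a pair of lists, `g` moves the translated head of the first onto the second. It rests once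
  -- the first is empty, so any number of iterations at least the length gives the same result.
  let g : ZFSet.{u} → ZFSet.{u} := fun z => if kfst z = ∅ then z else
    ZFSet.pair (ksnd (kfst z)) (ZFSet.pair (D (kfst (kfst z))) (ksnd z))
  have hg : PCSFMinus.Unary g :=
    PCSFMinus.ite_eq PCSFMinus.proj_zero
      (PCSFMinus.kpair_of (PCSFMinus.ksnd_of PCSFMinus.unary_kfst)
        (PCSFMinus.kpair_of (hD.of (PCSFMinus.kfst_of PCSFMinus.unary_kfst))
          PCSFMinus.unary_ksnd)) PCSFMinus.unary_kfst PCSFMinus.empty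
  have hgi : ∀ l : List α, ∀ N, l.length ≤ N → ∀ w : List β,
      g^[N] (ZFSet.pair (listCode e l) (listCode d w)) =
        ZFSet.pair ∅ (listCode d ((l.map φ).reverse ++ w)) := by
    intro l
    induction l with
    | nil => exact fun N _ w => Function.iterate_fixed (by simp [g, listCode]) N
    | cons a l ih =>
      rintro (_ | N) hN w
      · simp at hN
      · have hstep : g (ZFSet.pair (listCode e (a :: l)) (listCode d w)) =
            ZFSet.pair (listCode e l) (listCode d (φ a :: w)) := by
          simp [g, listCode, kpair_ne_empty, hDe a trivial (e a) rfl]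
        rw [Function.iterate_succ_apply, hstep, ih N (by simpa using hN)]
        simp
  obtain ⟨M, hM, hMi⟩ := exists_iterate_unary hg
  obtain ⟨ρ, hρ, hρr⟩ := exists_rank.{u}
  refine ⟨fun x y => ksnd (M (ρ x) (ZFSet.pair x y)), fun {n r t} hr ht => ?_, fun l w => ?_⟩
  · exact Normal.unary PCSFMinus.unary_ksnd (Normal.comp hM (r := fun _ x => ρ (r x))
      (t := fun _ x => ZFSet.pair (r x) (t x)) (fun _ => hρ hr) (fun _ => Normal.kpair hr ht))
  · obtain ⟨N, hN, hl⟩ := exists_hasRank_listCode her l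
    beta_reduce
    rw [hρr _ _ hl, hMi, hgi l N hN, ksnd_pair]

/-- The code of the word `s₁#…s_n#`, with respect to any coding of its letters, is in `PCSF` as a
function of the codes of the strings. -/
theorem PCSF.exists_tupleWord {n : ℕ} {e : Option Bool → ZFSet.{u}}
    (he : ∀ o, PCSFMinus.Unary (fun _ => e o)) :
    ∃ I : (Fin n → ZFSet.{u}) → ZFSet.{u}, Normal I ∧
      ∀ s : Fin n → List Bool, I (fun i => stringCode (s i)) = listCode e (tupleWord s) := by
  obtain ⟨T, hT, hTs⟩ := exists_reverseAppend bitCode_injective.{u}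
    (fun b => PCSFMinus.bitCode b) hasRank_bitCode he some
  have key : ∀ is : List (Fin n), ∃ I : (Fin n → ZFSet.{u}) → ZFSet.{u}, Normal I ∧
      ∀ s : Fin n → List Bool, I (fun i => stringCode (s i)) =
        listCode e ((is.map s).flatMap (fun w => w.map some ++ [none])) := by
    intro is
    induction is with
    | nil => exact ⟨fun _ => ∅, Normal.ofMinus PCSFMinus.null (t := fun j => j.elim0)
        (fun j => j.elim0), fun s => rfl⟩
    | cons i is ih =>
      obtain ⟨I, hI, hIs⟩ := ih
      refine ⟨fun x => T (x i) (ZFSet.pair (e none) (I x)), hT (normal_proj i) ?_, fun s => ?_⟩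
      · exact Normal.unary (PCSFMinus.kpair_of (he none) PCSFMinus.proj_zero) hI
      · beta_reduce
        rw [hIs, stringCode_eq_listCode]
        refine (hTs _ (none :: _)).trans ?_
        simp
  obtain ⟨I, hI, h⟩ := key (List.finRange n)
  exact ⟨I, hI, fun s => by rw [h, tupleWord, List.ofFn_eq_map]⟩

/-! ### Assembly of the simulation. -/

open Turing in
theorem lemma4p1 {n : ℕ} (f : (Fin n → List Bool) → List Bool) (hf : PolyTimeComputable f) :
    ∃ F : (Fin n → ZFSet.{u}) → (Fin 0 → ZFSet.{u}) → ZFSet.{u},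
      PCSF F ∧
        ∀ s : Fin n → List Bool,
          F (fun i => stringCode (s i)) Fin.elim0 = stringCode (f s) := by
  obtain ⟨⟨⟨tm, ia, oa⟩, p, hout⟩⟩ := hf
  have := tm.kFin
  have := tm.ΛFin
  have := tm.σFin
  have := tm.Γk₀Fin
  have : Finite (tm.Γ tm.k₁) := Finite.of_equiv _ oa.symm
  choose A hA hpush using fun l => (tm.m l).exists_pushesIn
  -- The alphabet contains all pushed symbols, all input symbols, and the whole output alphabet; the
  -- last makes the coding injective there, as decoding the output requires.
  obtain ⟨C, hC⟩ := TM2.Coding.exists_of_finite (Λ := tm.Λ) (σ := tm.σ)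
    ((Set.finite_iUnion hA).union ((Set.finite_range (Sigma.mk (β := tm.Γ) tm.k₀)).union
      (Set.finite_range (Sigma.mk (β := tm.Γ) tm.k₁))))
  have hM : ∀ l, (tm.m l).PushesIn C.alphabet := fun l => (hpush l).mono (by
    rw [hC]
    exact (Set.subset_iUnion A l).trans Set.subset_union_left)
  have hinit : ∀ w, TM2.StacksIn C.alphabet (initList tm w).stk := by
    intro w k g hg
    by_cases hk : k = tm.k₀
    · subst hk
      rw [hC]
      exact Or.inr (Or.inl ⟨g, rfl⟩)
    · simp [initList, hk] at hg
  have hinj : Function.Injective (C.symbolCode.{u} tm.k₁) := fun a b h =>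
    sigma_mk_injective (C.symbol_injOn (by rw [hC]; exact Or.inr (Or.inr ⟨a, rfl⟩))
      (by rw [hC]; exact Or.inr (Or.inr ⟨b, rfl⟩)) (Nat.succ_injective (zermelo_injective h)))
  have hks : ∀ k, k ∈ (Finset.univ : Finset tm.K).toList := by simp
  obtain ⟨G, hG, hGs⟩ := C.exists_steps.{u} hks hM
  obtain ⟨M, hMP, hMi⟩ := PCSF.exists_iterate_unary hG
  obtain ⟨ρ, hρ, hρr⟩ := PCSF.exists_rank.{u}
  obtain ⟨P, hP, hPe⟩ := PCSF.exists_polynomial.{u} p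
  obtain ⟨I, hI, hIs⟩ := PCSF.exists_tupleWord (n := n)
    (e := fun o => C.symbolCode.{u} tm.k₀ (ia.symm o)) (fun o => PCSFMinus.zermelo _)
  obtain ⟨π, hπ, hπs⟩ := exists_unary_component.{u} _ tm.k₁ (hks tm.k₁)
  obtain ⟨T, hT, hTs⟩ := PCSF.exists_reverseAppend hinj (fun g => PCSFMinus.zermelo _)
    (fun g => ⟨_, HasRank.zermelo _⟩) (fun b => PCSFMinus.bitCode.{u} b) oa
  -- `J` builds the initial configuration from the code of the input stack; every other stack is
  -- empty.
  let J : ZFSet.{u} → ZFSet.{u} := fun z => ZFSet.pair (zermelo (C.label (some tm.main)))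
    (ZFSet.pair (zermelo (C.state tm.initialState))
      (tupleCode (fun k => if k = tm.k₀ then z else ∅) (Finset.univ : Finset tm.K).toList))
  have hJ : PCSFMinus.Unary J := by
    refine PCSFMinus.kpair_of (PCSFMinus.zermelo _) (PCSFMinus.kpair_of (PCSFMinus.zermelo _)
      (PCSFMinus.tupleCode_of (fun k => ?_) _))
    split_ifs
    · exact PCSFMinus.proj_zero
    · exact PCSFMinus.empty
  have hJs : ∀ w, J (listCode (C.symbolCode tm.k₀) w) =
      C.cfgCode (Finset.univ : Finset tm.K).toList (initList tm w) := by
    intro w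
    refine congrArg (ZFSet.pair _) (congrArg (ZFSet.pair _) ?_)
    congr 1
    funext k
    by_cases hk : k = tm.k₀
    · subst hk
      simp [initList]
    · simp [initList, hk, listCode]
  -- The clock `P (ρ (I x))` is normal and the initial configuration safe. The output stack has its
  -- first letter outermost, so `T` reverses it onto `∅` to obtain a string code.
  have hF : PCSF.Normal (fun x => T (π (ksnd (ksnd (M (P (ρ (I x))) (J (I x)))))) ∅) := by
    refine hT (PCSF.Normal.unary hπ (PCSF.Normal.unary PCSFMinus.unary_ksnd
      (PCSF.Normal.unary PCSFMinus.unary_ksnd ?_))) ?_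
    · exact PCSF.Normal.comp hMP (r := fun _ x => P (ρ (I x))) (t := fun _ x => J (I x))
        (fun _ => hP (hρ hI)) (fun _ => PCSF.Normal.unary hJ hI)
    · exact PCSF.Normal.ofMinus PCSFMinus.null (t := fun j => j.elim0) (fun j => j.elim0)
  refine ⟨_, hF, fun s => ?_⟩
  obtain ⟨⟨N, hN⟩, hNle⟩ := hout s
  obtain ⟨m, hm, hrank⟩ := exists_hasRank_listCode
    (e := fun o => C.symbolCode.{u} tm.k₀ (ia.symm o)) (fun o => ⟨_, HasRank.zermelo _⟩)
    (tupleWord s)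
  -- The rank `m` is at least the input length and `p` is monotone, so `p.eval m` steps suffice;
  -- `rfl` says that the halting configuration has no successor.
  have hrun := iterate_getD_of_iterate_bind (N := p.eval m) hN rfl
    (hNle.trans (p.eval_mono_nat hm))
  have hIJ : J (I (fun i => stringCode (s i))) = C.cfgCode (Finset.univ : Finset tm.K).toList
      (initList tm ((tupleWord s).map ia.invFun)) := by
    rw [hIs, ← hJs, listCode_map]
    rfl
  have hstk : (haltList tm ((f s).map oa.invFun)).stk tm.k₁ = (f s).map oa.symm := by
    simp [haltList]
  have hfinal : π (ksnd (ksnd (M (P (ρ (I fun i => stringCode (s i))))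
      (J (I fun i => stringCode (s i)))))) =
      listCode (C.symbolCode tm.k₁) ((f s).map oa.symm) := by
    rw [hIJ, hIs, hρr _ _ hrank, hPe, hMi, hGs _ _ (hinit _)]
    exact (congrArg (fun c => π (ksnd (ksnd (C.cfgCode _ c)))) hrun).trans
      ((congrArg π (C.ksnd_ksnd_cfgCode _ _)).trans ((hπs _).trans (congrArg _ hstk)))
  beta_reduce
  rw [hfinal, stringCode_eq_listCode]
  refine (hTs _ []).trans ?_
  simp
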